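/- Let $N\ge 2$, $n\ge 1$, $d\ge 2$, and let $\mathcal I=(S^{d-1})^n$, where $S^{d-1}$ is the unit sphere of $\mathbb R^d$; write $X=(X_i)_{i=1}^n$ for its elements. Let $\sigma_1,\dots,\sigma_N:\mathbb R\to\mathbb R$ be functions with a Taylor decomposition on $\mathbb R$, i.e. $\sigma_i(x)=\sum_{t\ge 0}\frac{\sigma_i^{(t)}(0)}{t!}x^t$ for all $x\in\mathbb R$, and put $$f_i(x)=\sum_{t\ge 0}\frac{|\sigma_i^{(t)}(0)|}{t!}x^t,\qquad K_N(X,X')=f_N\circ\dots\circ f_2\Big(\sum_{i=1}^n f_1(\langle X_i,X_i'\rangle_{\mathbb R^d})\Big)\quad (X,X'\in\mathcal I).$$ Convolutional networks. Fix numbers of patches $n_0=n,n_1,\dots,n_N=1$ and patch sizes $d_0=d,d_1,\dots,d_N=n_{N-1}$, all at least $1$, with $n_{k+1}+d_{k+1}-1\le n_k$ for $0\le k<N$ (so that the patches below lie inside the image), and arbitrary real pooling factors $(\gamma^k_{i,q})_{1\le i,q\le n_k}$ for $0\le k<N$. Given numbers of filters $p_0=1$, $p_1,\dots,p_N\ge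 1$, and weights $w^k_j\in\mathbb R^{d_kp_k}$ ($0\le k<N$, $1\le j\le p_{k+1}$) and $W^N\in\mathbb R^{d_Np_N}$, define, starting from $X^0=X\in\mathcal I$, for $k=0,\dots,N-1$, $$\hat X^{k+1}_{i}=\Big(\sum_{q=1}^{n_k}\gamma^k_{i,q}\,\sigma_{k+1}\big(\langle X^k_q,w^k_j\rangle\big)\Big)_{j=1}^{p_{k+1}}\ (1\le i\le n_k),\qquad X^{k+1}_q=\big(\hat X^{k+1}_{q+\ell}\big)_{\ell=0}^{d_{k+1}-1}\ (1\le q\le n_{k+1}).$$ The network computes $\mathcal N_W(X)=\langle X^N_1,W^N\rangle$. Let $\mathcal F_{(\sigma_i)}$ be the set of all functions $\mathcal N_W$ on $\mathcal I$, over all $p_1,\dots,p_N\ge1$ and all weights. Then: 1. $K_N$ is a positive definite kernel on $\mathcal I$, that is, symmetric with $\sum_{a,b}c_ac_bK_N(x_a,x_b)\ge 0$ for all finite families $x_a\in\mathcal I$, $c_a\in\mathbb R$. 2. The reproducing kernel Hilbert space $H_N$ of $K_N$ contains $\mathcal F_{(\sigma_i)}$, for every choice of the $n_k$, $d_k$ and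 $\gamma^k$ as above. 3. If $\sigma_i^{(t)}(0)\ne 0$ for all $1\le i\le N$ and all $t\ge 0$, then $K_N$ is $c$-universal on $\mathcal I$: it is continuous, and $H_N$ is dense in $C(\mathcal I)$ for the uniform norm. -/

import Mathlib

namespace ConvKernel

/-! ### Positive definite kernels, their RKHS, and c-universality -/

section Kernels

variable {X : Type*}

/-- A real positive definite kernel (in the sense of RKHS theory, i.e. positive semi-definite):
a symmetric function all of whose finite Gram matrices are positive semi-definite. -/
def IsPosDefKernel (K : X → X → ℝ) : Prop :=
  (∀ x y, K x y = K y x) ∧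
    ∀ (m : ℕ) (x : Fin m → X) (c : Fin m → ℝ), 0 ≤ ∑ i, ∑ j, c i * c j * K (x i) (x j)

/-- A scalar kernel as a kernel with values in the operators on `ℝ`, the form in which Mathlib's
theory of reproducing kernel Hilbert spaces takes it. -/
noncomputable def operatorKernel (K : X → X → ℝ) : Matrix X X (ℝ →L[ℝ] ℝ) :=
  Matrix.of fun x y => K x y • ContinuousLinearMap.id ℝ ℝ

theorem IsPosDefKernel.posSemidef {K : X → X → ℝ} (hK : IsPosDefKernel K) :
    (operatorKernel K).PosSemidef := by
  refine ((RKHS.posSemidef_tfae (K := operatorKernel K)).out 0 2 rfl rfl).mpr ⟨?_, ?_⟩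
  · ext x y
    simp only [operatorKernel, Matrix.conjTranspose_apply, Matrix.of_apply, star_smul,
      hK.1 y x]
    simp [ContinuousLinearMap.star_eq_adjoint, ContinuousLinearMap.adjoint_id]
  · intro v
    have h := hK.2 v.support.card (fun i => (v.support.equivFin.symm i : X))
      (fun i => v (v.support.equivFin.symm i))
    have h2 : (∑ i, ∑ j, v (v.support.equivFin.symm i) * v (v.support.equivFin.symm j) *
        K (v.support.equivFin.symm i) (v.support.equivFin.symm j)) =
        ∑ x ∈ v.support, ∑ y ∈ v.support, v x * v y * K x y := by
      rw [← Finset.sum_coe_sort v.support (fun x => ∑ y ∈ v.support, v x * v y * K x y)]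
      rw [← v.support.equivFin.symm.sum_comp]
      refine Finset.sum_congr rfl fun i _ => ?_
      rw [← Finset.sum_coe_sort v.support, ← v.support.equivFin.symm.sum_comp]
    rw [h2] at h
    simp only [Finsupp.sum, operatorKernel, Matrix.of_apply]
    refine h.trans_eq ?_
    simp only [RCLike.re_to_real]
    refine Finset.sum_congr rfl fun x _ => Finset.sum_congr rfl fun y _ => ?_
    rw [hK.1 x y]
    simp
    ring

/-- The functions on `X` that belong to the reproducing kernel Hilbert space of the positive
definite kernel `K`. -/
def rkhsFunctions (K : X → X → ℝ) (hK : IsPosDefKernel K) : Set (X → ℝ) :=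
  haveI : Fact (operatorKernel K).PosSemidef := ⟨hK.posSemidef⟩
  {f | ∃ h : RKHS.OfKernel (operatorKernel K), ⇑h = f}

/-- c-universality on a compact Hausdorff space: `K` is a continuous positive definite kernel
whose RKHS is dense in `C(X, ℝ)` for the uniform norm. -/
def IsCUniversal [TopologicalSpace X] [CompactSpace X] [T2Space X] (K : X → X → ℝ) : Prop :=
  Continuous (fun z : X × X => K z.1 z.2) ∧
    ∃ hK : IsPosDefKernel K, Dense {g : C(X, ℝ) | ⇑g ∈ rkhsFunctions K hK}

end Kernels

/-! ### Activation functions and the multi-layer kernel -/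

/-- `σ` is the sum of its Taylor series at `0`, on all of `ℝ`. -/
def HasTaylorOnReal (σ : ℝ → ℝ) : Prop :=
  ∀ x : ℝ, HasSum (fun t : ℕ => iteratedDeriv t σ 0 / (t.factorial : ℝ) * x ^ t) (σ x)

/-- The function `f(x) = ∑ₜ |σ⁽ᵗ⁾(0)| / t! · xᵗ`. -/
noncomputable def absTaylor (σ : ℝ → ℝ) (x : ℝ) : ℝ :=
  ∑' t : ℕ, |iteratedDeriv t σ 0| / (t.factorial : ℝ) * x ^ t

theorem HasTaylorOnReal.hasSum_absTaylor {σ : ℝ → ℝ} (hσ : HasTaylorOnReal σ) (x : ℝ) :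
    HasSum (fun t : ℕ => |iteratedDeriv t σ 0| / (t.factorial : ℝ) * x ^ t) (absTaylor σ x) := by
  refine Summable.hasSum (Summable.of_abs ?_)
  have h := (hσ x).summable.abs
  refine h.congr fun t => ?_
  simp [abs_mul, abs_div]

/-- `iterComp f N = f_N ∘ ⋯ ∘ f_2` for `N ≥ 2` (the identity for `N = 0, 1`). -/
def iterComp (f : ℕ → ℝ → ℝ) : ℕ → ℝ → ℝ
  | 0 => id
  | 1 => id
  | k + 2 => f (k + 2) ∘ iterComp f (k + 1)

/-- The space `(S^{d-1})^n` of images given by `n` normalized patches of size `d`. -/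
abbrev ImageSpace (n d : ℕ) : Type :=
  Fin n → Metric.sphere (0 : EuclideanSpace ℝ (Fin d)) 1

/-- `K_N(X, X') = f_N ∘ ⋯ ∘ f_2 (∑ᵢ f_1 ⟨Xᵢ, X'ᵢ⟩)` where `f_i` is the series attached to `σ i`. -/
noncomputable def multiLayerKernel (N n d : ℕ) (σ : ℕ → ℝ → ℝ) (X X' : ImageSpace n d) : ℝ :=
  iterComp (fun i => absTaylor (σ i)) N
    (∑ i : Fin n, absTaylor (σ 1)
      (inner ℝ (X i : EuclideanSpace ℝ (Fin d)) (X' i : EuclideanSpace ℝ (Fin d))))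

/-! ### Convolutional networks -/

/-- The fixed data of a convolutional network with `N` hidden layers on `(S^{d-1})^n`: the numbers
of patches `n_0, …, n_N`, the patch sizes `d_0, …, d_N`, and the pooling factors. There is a single
patch, the full image, at the prediction layer. Only the entries up to `N` matter. -/
structure Architecture (N n d : ℕ) where
  numPatches : ℕ → ℕ
  patchSize : ℕ → ℕ
  numPatches_zero : numPatches 0 = n
  patchSize_zero : patchSize 0 = d
  patchSize_pos : ∀ k ≤ N, 0 < patchSize k
  /-- The patches `(U_{q+ℓ})` of the next layer lie inside the current image. -/
  fits : ∀ k < N, numPatches (k + 1) + patchSize (k + 1) ≤ numPatches k + 1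
  numPatches_last : numPatches N = 1
  patchSize_last : patchSize N = numPatches (N - 1)
  pooling : (k : ℕ) → Fin (numPatches k) → Fin (numPatches k) → ℝ

namespace Architecture

variable {N n d : ℕ} (A : Architecture N n d)

/-- The weights of a network with `p k` channels at layer `k`. The vector `w_j^k ∈ ℝ^{d_k p_k}`
is indexed by pairs (position in the patch, channel). -/
structure Weights (p : ℕ → ℕ) where
  filter : (k : ℕ) → Fin (p (k + 1)) → Fin (A.patchSize k) → Fin (p k) → ℝ
  prediction : Fin (A.patchSize N) → Fin (p N) → ℝ

variable {A} {p : ℕ → ℕ}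

/-- The patch extraction operators `P_q(U) = (U_{q+ℓ})_{0 ≤ ℓ < d_{k+1}}`. -/
def extractPatch {k : ℕ} (hk : k < N) (U : Fin (A.numPatches k) → Fin (p (k + 1)) → ℝ)
    (q : Fin (A.numPatches (k + 1))) (l : Fin (A.patchSize (k + 1))) : Fin (p (k + 1)) → ℝ :=
  U ⟨q.1 + l.1, by have := A.fits k hk; have := q.2; have := l.2; omega⟩

/-- Convolution, nonlinearity and pooling at layer `k`:
`Z(i, j) = ∑_q γ_{i,q} s(⟨X_q, w_j⟩)`, for the activation `s`. -/
def convPool (W : A.Weights p) (s : ℝ → ℝ) (k : ℕ)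
    (X : Fin (A.numPatches k) → Fin (A.patchSize k) → Fin (p k) → ℝ)
    (i : Fin (A.numPatches k)) (j : Fin (p (k + 1))) : ℝ :=
  ∑ q, A.pooling k i q * s (∑ l, ∑ m, X q l m * W.filter k j l m)

/-- The representation `X^k` of the image at layer `k ≤ N`: `n_k` patches, each of `d_k` pixels
with `p k` channels. The input has one channel, and the step from `X^k` to `X^{k+1}` uses the
activation `σ (k + 1)`. -/
def representation (W : A.Weights p) (σ : ℕ → ℝ → ℝ) (X : ImageSpace n d) :
    (k : ℕ) → k ≤ N → Fin (A.numPatches k) → Fin (A.patchSize k) → Fin (p k) → ℝ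
  | 0, _ => fun i l _ =>
      (X (Fin.cast A.numPatches_zero i) : EuclideanSpace ℝ (Fin d)) (Fin.cast A.patchSize_zero l)
  | k + 1, hk =>
      extractPatch hk (convPool W (σ (k + 1)) k (representation W σ X k (Nat.le_of_succ_le hk)))

/-- The function computed by the network: the inner product of the only patch of `X^N` with the
weights of the prediction layer. -/
def networkFunction (W : A.Weights p) (σ : ℕ → ℝ → ℝ) (X : ImageSpace n d) : ℝ :=
  ∑ l, ∑ m, representation W σ X N le_rfl (Fin.cast A.numPatches_last.symm 0) l m *
    W.prediction l m

variable (A)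

/-- All functions computed by the networks with architecture `A` and activations `σ`, for any
numbers `p_1, …, p_N ≥ 1` of filters (and `p_0 = 1`) and any weights. -/
def networkFunctions (σ : ℕ → ℝ → ℝ) : Set (ImageSpace n d → ℝ) :=
  ⋃ (p : ℕ → ℕ) (_ : p 0 = 1 ∧ ∀ k ∈ Finset.Icc 1 N, 1 ≤ p k),
    {f | ∃ W : A.Weights p, f = networkFunction W σ}

end Architecture

end ConvKernel

open scoped InnerProductSpace

namespace ConvKernel

section Kernels

/-! A function `g` lies in the RKHS of `K` as soon as `C * K - g ⊗ g` is positive definite for some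
`C ≥ 0` (`IsDominated.mem_rkhsFunctions`, by Riesz), so everything reduces to the calculus of this
domination. It is stable under linear combinations and products, and `IsDominated.powerSeries`
passes it through a layer: if `K` dominates `g`, then `f ∘ K` dominates `s ∘ g`, where `f` has the
absolute values of the Taylor coefficients of `s`. Induction over the layers then covers every
network.

For universality, coordinates are dominated by `K_1`, hence monomials of degree `t` by `K_1 ^ t`.
Since every coefficient of `f_2` is positive, `f_2 ∘ K_1` dominates all polynomials in the
coordinates; the later layers keep them through their linear terms. Stone–Weierstrass concludes. -/

theorem sq_sum_mul {ι : Type*} (s : Finset ι) (c u : ι → ℝ) :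
    (∑ i ∈ s, c i * u i) ^ 2 = ∑ i ∈ s, ∑ j ∈ s, c i * c j * (u i * u j) := by
  rw [sq, Finset.sum_mul_sum]
  exact Finset.sum_congr rfl fun i _ => Finset.sum_congr rfl fun j _ => by ring

variable {X Y : Type*} {K L : X → X → ℝ} {g h : X → ℝ}

/-! ### Closure properties of positive definite kernels. -/

namespace IsPosDefKernel

theorem sum_nonneg (hK : IsPosDefKernel K) (s : Finset X) (v : X → ℝ) :
    0 ≤ ∑ x ∈ s, ∑ y ∈ s, v x * v y * K x y := by
  have h := hK.2 s.card (fun i => (s.equivFin.symm i : X)) (fun i => v (s.equivFin.symm i))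
  refine h.trans_eq ?_
  rw [← Finset.sum_coe_sort s (fun x => ∑ y ∈ s, v x * v y * K x y), ← s.equivFin.symm.sum_comp]
  refine Finset.sum_congr rfl fun i _ => ?_
  rw [← Finset.sum_coe_sort s, ← s.equivFin.symm.sum_comp]

theorem add (hK : IsPosDefKernel K) (hL : IsPosDefKernel L) :
    IsPosDefKernel fun x y => K x y + L x y := by
  refine ⟨fun x y => by simp only [hK.1 x y, hL.1 x y], fun m x c => ?_⟩
  simpa only [mul_add, Finset.sum_add_distrib] using add_nonneg (hK.2 m x c) (hL.2 m x c)

theorem const_mul (hK : IsPosDefKernel K) {a : ℝ} (ha : 0 ≤ a) :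
    IsPosDefKernel fun x y => a * K x y := by
  refine ⟨fun x y => by simp only [hK.1 x y], fun m x c => ?_⟩
  simpa only [mul_left_comm _ a, ← Finset.mul_sum] using mul_nonneg ha (hK.2 m x c)

theorem rankOne (g : X → ℝ) : IsPosDefKernel fun x y => g x * g y := by
  refine ⟨fun _ _ => mul_comm _ _, fun m x c => ?_⟩
  rw [← sq_sum_mul _ c fun i => g (x i)]
  positivity

theorem comp (hK : IsPosDefKernel K) (φ : Y → X) : IsPosDefKernel fun x y => K (φ x) (φ y) :=
  ⟨fun _ _ => hK.1 _ _, fun m x c => hK.2 m (φ ∘ x) c⟩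

theorem gram_posSemidef (hK : IsPosDefKernel K) {m : ℕ} (x : Fin m → X) :
    (Matrix.of fun i j => K (x i) (x j)).PosSemidef := by
  refine Matrix.PosSemidef.of_dotProduct_mulVec_nonneg ?_ fun c => ?_
  · ext i j
    simp [hK.1 (x j) (x i)]
  · refine (hK.2 m x c).trans_eq ?_
    simp only [dotProduct, Matrix.mulVec, Pi.star_apply, star_trivial, Matrix.of_apply,
      Finset.mul_sum]
    exact Finset.sum_congr rfl fun i _ => Finset.sum_congr rfl fun j _ => by ring

/-- Schur product theorem for the Gram matrices. -/
theorem mul (hK : IsPosDefKernel K) (hL : IsPosDefKernel L) :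
    IsPosDefKernel fun x y => K x y * L x y := by
  refine ⟨fun x y => by simp only [hK.1 x y, hL.1 x y], fun m x c => ?_⟩
  refine (((hK.gram_posSemidef x).hadamard (hL.gram_posSemidef x)).dotProduct_mulVec_nonneg
    c).trans_eq ?_
  simp only [dotProduct, Matrix.mulVec, Pi.star_apply, star_trivial, Matrix.of_apply,
    Finset.mul_sum, Matrix.hadamard_apply]
  exact Finset.sum_congr rfl fun i _ => Finset.sum_congr rfl fun j _ => by ring

theorem pow (hK : IsPosDefKernel K) (t : ℕ) : IsPosDefKernel fun x y => K x y ^ t := by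
  induction t with
  | zero => simpa using rankOne fun _ : X => (1 : ℝ)
  | succ t ih => simpa only [pow_succ] using ih.mul hK

theorem sum {ι : Type*} (s : Finset ι) {K : ι → X → X → ℝ}
    (hK : ∀ i ∈ s, IsPosDefKernel (K i)) : IsPosDefKernel fun x y => ∑ i ∈ s, K i x y := by
  classical
  induction s using Finset.induction_on with
  | empty => simpa using rankOne fun _ : X => (0 : ℝ)
  | insert i s hi ih =>
    simpa only [Finset.sum_insert hi] using
      (hK i (Finset.mem_insert_self i s)).add (ih fun j hj => hK j (Finset.mem_insert_of_mem hj))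

theorem hasSum_quadForm {a : ℕ → ℝ} {f : ℝ → ℝ}
    (hf : ∀ z, HasSum (fun t => a t * z ^ t) (f z)) {m : ℕ} (K : X → X → ℝ) (x : Fin m → X)
    (c : Fin m → ℝ) :
    HasSum (fun t => a t * ∑ i, ∑ j, c i * c j * K (x i) (x j) ^ t)
      (∑ i, ∑ j, c i * c j * f (K (x i) (x j))) := by
  have := hasSum_sum (s := Finset.univ) fun i (_ : i ∈ Finset.univ) =>
    hasSum_sum (s := Finset.univ) fun j (_ : j ∈ Finset.univ) =>
      (hf (K (x i) (x j))).mul_left (c i * c j)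
  refine this.congr_fun fun t => ?_
  simp only [Finset.mul_sum]
  exact Finset.sum_congr rfl fun i _ => Finset.sum_congr rfl fun j _ => by ring

theorem powerSeries {a : ℕ → ℝ} {f : ℝ → ℝ} (hK : IsPosDefKernel K) (ha : ∀ t, 0 ≤ a t)
    (hf : ∀ z, HasSum (fun t => a t * z ^ t) (f z)) : IsPosDefKernel fun x y => f (K x y) :=
  ⟨fun x y => by simp only [hK.1 x y], fun m x c => (hasSum_quadForm hf K x c).nonneg fun t =>
    mul_nonneg (ha t) ((hK.pow t).2 m x c)⟩

/-- Each quadratic form of `f ∘ K` is a series of nonnegative terms, so it is at least its `t`-th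
term. -/
theorem powerSeries_sub_term {a : ℕ → ℝ} {f : ℝ → ℝ} (hK : IsPosDefKernel K) (ha : ∀ t, 0 ≤ a t)
    (hf : ∀ z, HasSum (fun t => a t * z ^ t) (f z)) (t : ℕ) :
    IsPosDefKernel fun x y => f (K x y) - a t * K x y ^ t := by
  refine ⟨fun x y => by simp only [hK.1 x y], fun m x c => ?_⟩
  have := le_hasSum (hasSum_quadForm hf K x c) t fun s _ =>
    mul_nonneg (ha s) ((hK.pow s).2 m x c)
  simp only [mul_sub, Finset.sum_sub_distrib, mul_left_comm _ (a t), ← Finset.mul_sum]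
  linarith

end IsPosDefKernel

/-- `g ⊗ g` is dominated by a multiple of `K`; such a `g` belongs to the RKHS of `K`. -/
def IsDominated (K : X → X → ℝ) (g : X → ℝ) : Prop :=
  ∃ C : ℝ, 0 ≤ C ∧ IsPosDefKernel fun x y => C * K x y - g x * g y

/-! ### Closure properties of domination. -/

namespace IsDominated

theorem mono (hg : IsDominated K g) (hKL : IsPosDefKernel fun x y => L x y - K x y) :
    IsDominated L g := by
  obtain ⟨C, hC, h⟩ := hg
  refine ⟨C, hC, ?_⟩
  convert! (hKL.const_mul hC).add h using 3
  ring

theorem const_mul_kernel {a : ℝ} (ha : 0 < a) (hg : IsDominated K g) :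
    IsDominated (fun x y => a * K x y) g := by
  obtain ⟨C, hC, h⟩ := hg
  refine ⟨C / a, by positivity, ?_⟩
  convert! h using 3
  field_simp

theorem add (hg : IsDominated K g) (hh : IsDominated K h) :
    IsDominated K (fun x => g x + h x) := by
  obtain ⟨C, hC, h1⟩ := hg
  obtain ⟨D, hD, h2⟩ := hh
  refine ⟨2 * C + 2 * D, by positivity, ?_⟩
  -- Parallelogram identity: `2 g ⊗ g + 2 h ⊗ h - (g + h) ⊗ (g + h) = (g - h) ⊗ (g - h)`.
  convert! ((h1.const_mul zero_le_two).add (h2.const_mul zero_le_two)).add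
    (IsPosDefKernel.rankOne fun x => g x - h x) using 3
  ring

theorem const_mul (a : ℝ) (hg : IsDominated K g) : IsDominated K (fun x => a * g x) := by
  obtain ⟨C, hC, h1⟩ := hg
  refine ⟨a ^ 2 * C, by positivity, ?_⟩
  convert! h1.const_mul (sq_nonneg a) using 3
  ring

theorem zero (hK : IsPosDefKernel K) : IsDominated K (fun _ => 0) :=
  ⟨1, zero_le_one, by simpa using hK⟩

theorem sum {ι : Type*} (hK : IsPosDefKernel K) (s : Finset ι) {g : ι → X → ℝ}
    (hg : ∀ i ∈ s, IsDominated K (g i)) : IsDominated K fun x => ∑ i ∈ s, g i x := by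
  classical
  induction s using Finset.induction_on with
  | empty => simpa using zero hK
  | insert i s hi ih =>
    simpa only [Finset.sum_insert hi] using
      (hg i (Finset.mem_insert_self i s)).add (ih fun j hj => hg j (Finset.mem_insert_of_mem hj))

theorem mul (hL : IsPosDefKernel L) (hg : IsDominated K g) (hh : IsDominated L h) :
    IsDominated (fun x y => K x y * L x y) (fun x => g x * h x) := by
  obtain ⟨C, hC, h1⟩ := hg
  obtain ⟨D, hD, h2⟩ := hh
  refine ⟨C * D, by positivity, ?_⟩
  -- `CK·DL - gh ⊗ gh = (CK - g ⊗ g)·DL + (g ⊗ g)·(DL - h ⊗ h)`.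
  convert! (h1.mul (hL.const_mul hD)).add ((IsPosDefKernel.rankOne g).mul h2) using 3
  ring

/-- Domination of each power `g ^ t` by `C ^ t * K ^ t` is summed over `t` by Cauchy–Schwarz with
weights `|a t|`; the weights `|a t| * C ^ t` add up to the constant `f C`. -/
theorem powerSeries {a : ℕ → ℝ} {s f : ℝ → ℝ} (hK : IsPosDefKernel K)
    (hs : ∀ z, HasSum (fun t => a t * z ^ t) (s z))
    (hf : ∀ z, HasSum (fun t => |a t| * z ^ t) (f z)) (hg : IsDominated K g) :
    IsDominated (fun x y => f (K x y)) (fun x => s (g x)) := by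
  obtain ⟨C, hC, h⟩ := hg
  have hpow (t : ℕ) : IsPosDefKernel fun x y => C ^ t * K x y ^ t - g x ^ t * g y ^ t := by
    induction t with
    | zero => simpa using IsPosDefKernel.rankOne fun _ : X => (0 : ℝ)
    | succ t ih =>
      convert! (ih.mul (hK.const_mul hC)).add
        ((IsPosDefKernel.rankOne fun x => g x ^ t).mul h) using 3
      ring
  refine ⟨f C, (hf C).nonneg fun t => by positivity,
    fun x y => by simp only [hK.1 x y, mul_comm (s (g x))], fun m x c => ?_⟩
  have hQ := IsPosDefKernel.hasSum_quadForm hf K x c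
  have hS : HasSum (fun t => a t * ∑ i, c i * g (x i) ^ t) (∑ i, c i * s (g (x i))) := by
    have := hasSum_sum (s := Finset.univ) fun i (_ : i ∈ Finset.univ) =>
      (hs (g (x i))).mul_left (c i)
    refine this.congr_fun fun t => ?_
    simp only [Finset.mul_sum]
    exact Finset.sum_congr rfl fun i _ => by ring
  have hterm (t : ℕ) : (∑ i, c i * g (x i) ^ t) ^ 2 ≤
      C ^ t * ∑ i, ∑ j, c i * c j * K (x i) (x j) ^ t := by
    have h1 := (hpow t).2 m x c
    rw [sq_sum_mul, Finset.mul_sum, ← sub_nonneg, ← Finset.sum_sub_distrib]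
    refine h1.trans_eq (Finset.sum_congr rfl fun i _ => ?_)
    rw [Finset.mul_sum, ← Finset.sum_sub_distrib]
    exact Finset.sum_congr rfl fun j _ => by ring
  have key : (∑ i, c i * s (g (x i))) ^ 2 ≤
      f C * ∑ i, ∑ j, c i * c j * f (K (x i) (x j)) := by
    -- Cauchy–Schwarz on finite sets of exponents, then passage to the limit.
    refine le_of_tendsto_of_tendsto' (hS.pow 2) (Filter.Tendsto.mul (hf C) hQ) fun T => ?_
    refine Finset.sum_sq_le_sum_mul_sum_of_sq_le_mul T (fun t _ => by positivity)
      (fun t _ => mul_nonneg (abs_nonneg _) ((hK.pow t).2 m x c)) fun t _ => ?_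
    rw [mul_pow, ← sq_abs (a t)]
    have := mul_le_mul_of_nonneg_left (hterm t) (sq_nonneg |a t|)
    linarith
  rw [sq_sum_mul, Finset.mul_sum, ← sub_nonneg, ← Finset.sum_sub_distrib] at key
  refine key.trans_eq (Finset.sum_congr rfl fun i _ => ?_)
  rw [Finset.mul_sum, ← Finset.sum_sub_distrib]
  exact Finset.sum_congr rfl fun j _ => by ring

end IsDominated

/-! ### From domination to membership in the RKHS. -/

/-- The bound forces `ker T ≤ ker l`, so `l` descends to a bounded functional on the range of `T`;
Hahn–Banach extends it to `H` and Riesz represents it. -/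
theorem exists_inner_eq_of_le_norm {V H : Type*} [AddCommGroup V] [Module ℝ V]
    [NormedAddCommGroup H] [InnerProductSpace ℝ H] [CompleteSpace H] (T : V →ₗ[ℝ] H)
    (l : V →ₗ[ℝ] ℝ) (C : ℝ) (h : ∀ v, |l v| ≤ C * ‖T v‖) :
    ∃ w : H, ∀ v, l v = ⟪w, T v⟫_ℝ := by
  have hker : l ∈ T.dualMap.range := by
    rw [LinearMap.range_dualMap_eq_dualAnnihilator_ker, Submodule.mem_dualAnnihilator]
    intro v hv
    have := h v
    rw [LinearMap.mem_ker.1 hv, norm_zero, mul_zero] at this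
    exact abs_nonpos_iff.1 this
  obtain ⟨l', hl'⟩ := hker
  have hl (v : V) : l v = l' (T v) := by rw [← hl']; rfl
  let φ : StrongDual ℝ T.range := (l'.domRestrict T.range).mkContinuous C (by
    rintro ⟨_, v, rfl⟩
    simpa [hl] using h v)
  obtain ⟨ψ, hψ, -⟩ := exists_extension_norm_eq T.range φ
  refine ⟨(InnerProductSpace.toDual ℝ H).symm ψ, fun v => ?_⟩
  rw [InnerProductSpace.toDual_symm_apply, hl]
  exact (hψ ⟨T v, v, rfl⟩).symm

theorem IsDominated.mem_rkhsFunctions (hK : IsPosDefKernel K) (hg : IsDominated K g) :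
    g ∈ rkhsFunctions K hK := by
  obtain ⟨C, hC, hg⟩ := hg
  have : Fact (operatorKernel K).PosSemidef := ⟨hK.posSemidef⟩
  let H := RKHS.OfKernel (operatorKernel K)
  let k : X → H := fun x => RKHS.kerFun H x 1
  have hk (x y : X) : ⟪k x, k y⟫_ℝ = K x y := by
    rw [← RKHS.kernel_inner, RKHS.OfKernel.kernel_ofKernel, hK.1 x y]
    simp [operatorKernel]
  -- The bound `|∑ v x * g x| ≤ √C * ‖∑ v x • k x‖`, once squared, is exactly domination.
  obtain ⟨w, hw⟩ := exists_inner_eq_of_le_norm (Finsupp.linearCombination ℝ k)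
    (Finsupp.linearCombination ℝ g) (Real.sqrt C) fun v => by
      have h1 := hg.sum_nonneg v.support v
      have h2 : ‖Finsupp.linearCombination ℝ k v‖ ^ 2 =
          ∑ x ∈ v.support, ∑ y ∈ v.support, v x * v y * K x y := by
        rw [← real_inner_self_eq_norm_sq, Finsupp.linearCombination_apply, Finsupp.sum, sum_inner]
        refine Finset.sum_congr rfl fun x _ => ?_
        rw [inner_sum]
        refine Finset.sum_congr rfl fun y _ => ?_
        rw [real_inner_smul_left, real_inner_smul_right, hk]
        ring
      refine abs_le_of_sq_le_sq ?_ (by positivity)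
      rw [mul_pow, Real.sq_sqrt hC, h2, Finsupp.linearCombination_apply, Finsupp.sum]
      simp only [smul_eq_mul]
      rw [sq_sum_mul, Finset.mul_sum, ← sub_nonneg, ← Finset.sum_sub_distrib]
      refine h1.trans_eq (Finset.sum_congr rfl fun x _ => ?_)
      rw [Finset.mul_sum, ← Finset.sum_sub_distrib]
      exact Finset.sum_congr rfl fun y _ => by ring
  refine ⟨w, funext fun x => ?_⟩
  -- On a point mass, the reproducing property turns `⟪w, k x⟫` into the value of `w` at `x`.
  have := hw (Finsupp.single x 1)
  simp only [Finsupp.linearCombination_single, one_smul, k, RKHS.inner_kerFun] at this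
  simpa using this.symm

end Kernels

/-! ### Power series, polynomials and inner products. -/

theorem continuous_of_hasSum_pow {a : ℕ → ℝ} {f : ℝ → ℝ} (ha : ∀ t, 0 ≤ a t)
    (hf : ∀ z, HasSum (fun t => a t * z ^ t) (f z)) : Continuous f := by
  have hfun : f = fun z => ∑' t, a t * z ^ t := funext fun z => (hf z).tsum_eq.symm
  refine continuous_iff_continuousAt.2 fun z => ?_
  have hz : Set.Icc (-(|z| + 1)) (|z| + 1) ∈ nhds z := by
    apply Icc_mem_nhds <;> [have := neg_abs_le z; have := le_abs_self z] <;> linarith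
  refine ContinuousOn.continuousAt ?_ hz
  rw [hfun]
  -- Weierstrass M-test: as `a t ≥ 0`, the series at `|z| + 1` is the majorant.
  refine continuousOn_tsum (fun t => by fun_prop) (hf (|z| + 1)).summable fun t x hx => ?_
  rw [norm_mul, norm_pow, Real.norm_of_nonneg (ha t)]
  exact mul_le_mul_of_nonneg_left (pow_le_pow_left₀ (norm_nonneg x) (abs_le.2 hx) t) (ha t)

/-- The exponent is the number of factors taken from `s`. -/
theorem IsDominated.exists_pow_of_mem_closure {X : Type*} [TopologicalSpace X] {K : X → X → ℝ}
    (hK : IsPosDefKernel K) {s : Set C(X, ℝ)} (hs : ∀ g ∈ s, IsDominated K g) {p : C(X, ℝ)}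
    (hp : p ∈ Submonoid.closure s) : ∃ t : ℕ, IsDominated (fun x y => K x y ^ t) p := by
  induction hp using Submonoid.closure_induction with
  | mem g hg => exact ⟨1, by simpa using hs g hg⟩
  | one => exact ⟨0, 1, zero_le_one, by simpa using IsPosDefKernel.rankOne fun _ : X => (0 : ℝ)⟩
  | mul g h _ _ hg hh =>
    obtain ⟨t, hg⟩ := hg
    obtain ⟨u, hh⟩ := hh
    refine ⟨t + u, ?_⟩
    simp only [pow_add]
    exact hg.mul (hK.pow u) hh

theorem IsDominated.of_pow {X : Type*} {K : X → X → ℝ} {g : X → ℝ} {a : ℕ → ℝ} {f : ℝ → ℝ}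
    (hK : IsPosDefKernel K) (ha : ∀ t, 0 ≤ a t) (hf : ∀ z, HasSum (fun t => a t * z ^ t) (f z))
    {t : ℕ} (hat : 0 < a t) (hg : IsDominated (fun x y => K x y ^ t) g) :
    IsDominated (fun x y => f (K x y)) g :=
  (hg.const_mul_kernel hat).mono (hK.powerSeries_sub_term ha hf t)

/-- The algebra is spanned by monomials in `s`. Their degrees are unbounded, which is why all
coefficients `a t` must be positive. -/
theorem IsDominated.mem_of_mem_adjoin {X : Type*} [TopologicalSpace X] {K : X → X → ℝ}
    (hK : IsPosDefKernel K) {a : ℕ → ℝ} {f : ℝ → ℝ} (ha : ∀ t, 0 < a t)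
    (hf : ∀ z, HasSum (fun t => a t * z ^ t) (f z)) {s : Set C(X, ℝ)}
    (hs : ∀ g ∈ s, IsDominated K g) {p : C(X, ℝ)} (hp : p ∈ Algebra.adjoin ℝ s) :
    IsDominated (fun x y => f (K x y)) p := by
  have ha' t := (ha t).le
  rw [← Subalgebra.mem_toSubmodule, Algebra.adjoin_eq_span] at hp
  induction hp using Submodule.span_induction with
  | mem g hg =>
    obtain ⟨t, ht⟩ := exists_pow_of_mem_closure hK hs hg
    exact of_pow hK ha' hf (ha t) ht
  | zero => exact zero (hK.powerSeries ha' hf)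
  | add g h _ _ hg hh => exact hg.add hh
  | smul c g _ hg => exact hg.const_mul c

theorem norm_sq_sum_smul {ι E : Type*} [NormedAddCommGroup E] [InnerProductSpace ℝ E]
    (s : Finset ι) (c : ι → ℝ) (x : ι → E) :
    ‖∑ i ∈ s, c i • x i‖ ^ 2 = ∑ i ∈ s, ∑ j ∈ s, c i * c j * ⟪x i, x j⟫_ℝ := by
  rw [← real_inner_self_eq_norm_sq, sum_inner]
  simp only [inner_sum, real_inner_smul_left, real_inner_smul_right, mul_assoc, mul_left_comm]

theorem isPosDefKernel_inner (E : Type*) [NormedAddCommGroup E] [InnerProductSpace ℝ E] :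
    IsPosDefKernel fun x y : E => ⟪x, y⟫_ℝ := by
  refine ⟨fun x y => real_inner_comm _ _, fun m x c => ?_⟩
  rw [← norm_sq_sum_smul]
  positivity

theorem isDominated_inner {E : Type*} [NormedAddCommGroup E] [InnerProductSpace ℝ E] (w : E) :
    IsDominated (fun x y : E => ⟪x, y⟫_ℝ) fun x => ⟪w, x⟫_ℝ := by
  refine ⟨‖w‖ ^ 2, by positivity, fun x y => ?_, fun m x c => ?_⟩
  · simp only [real_inner_comm x y, mul_comm]
  · have h2 : ∑ i, c i * ⟪w, x i⟫_ℝ = ⟪w, ∑ i, c i • x i⟫_ℝ := by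
      simp only [inner_sum, real_inner_smul_right]
    have key : (∑ i, c i * ⟪w, x i⟫_ℝ) ^ 2 ≤
        ‖w‖ ^ 2 * ∑ i, ∑ j, c i * c j * ⟪x i, x j⟫_ℝ := by
      rw [← norm_sq_sum_smul, h2, ← mul_pow]
      exact sq_le_sq.2 ((abs_real_inner_le_norm _ _).trans (le_abs_self _))
    rw [sq_sum_mul, Finset.mul_sum, ← sub_nonneg, ← Finset.sum_sub_distrib] at key
    refine key.trans_eq (Finset.sum_congr rfl fun i _ => ?_)
    rw [Finset.mul_sum, ← Finset.sum_sub_distrib]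
    exact Finset.sum_congr rfl fun j _ => by ring

/-! ### The multi-layer kernel and the networks. -/

section Layers

variable {N n d : ℕ} {σ : ℕ → ℝ → ℝ}

theorem HasTaylorOnReal.hasSum_abs_coeff {s : ℝ → ℝ} (hs : HasTaylorOnReal s) (z : ℝ) :
    HasSum (fun t : ℕ => |iteratedDeriv t s 0 / (t.factorial : ℝ)| * z ^ t) (absTaylor s z) := by
  simpa [abs_div] using hs.hasSum_absTaylor z

theorem HasTaylorOnReal.continuous_absTaylor {s : ℝ → ℝ} (hs : HasTaylorOnReal s) :
    Continuous (absTaylor s) :=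
  continuous_of_hasSum_pow (fun _ => abs_nonneg _) hs.hasSum_abs_coeff

/-- The kernel `⟨Xᵢ, X'ᵢ⟩` comparing the patches at position `i`. -/
noncomputable def patchKernel (i : Fin n) (X X' : ImageSpace n d) : ℝ :=
  ⟪(X i : EuclideanSpace ℝ (Fin d)), (X' i : EuclideanSpace ℝ (Fin d))⟫_ℝ

theorem isPosDefKernel_patchKernel (i : Fin n) : IsPosDefKernel (patchKernel (d := d) i) :=
  (isPosDefKernel_inner _).comp fun X : ImageSpace n d => (X i : EuclideanSpace ℝ (Fin d))

theorem isDominated_patchKernel (i : Fin n) (w : EuclideanSpace ℝ (Fin d)) :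
    IsDominated (patchKernel i) fun X : ImageSpace n d => ⟪w, (X i).1⟫_ℝ := by
  obtain ⟨C, hC, h⟩ := isDominated_inner w
  exact ⟨C, hC, h.comp fun X : ImageSpace n d => (X i : EuclideanSpace ℝ (Fin d))⟩

theorem isPosDefKernel_absTaylor_patchKernel {s : ℝ → ℝ} (hs : HasTaylorOnReal s) (i : Fin n) :
    IsPosDefKernel fun X X' : ImageSpace n d => absTaylor s (patchKernel i X X') :=
  (isPosDefKernel_patchKernel i).powerSeries (fun _ => abs_nonneg _) hs.hasSum_abs_coeff

theorem IsDominated.multiLayerKernel_one (h1 : HasTaylorOnReal (σ 1)) (i : Fin n)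
    {g : ImageSpace n d → ℝ}
    (hg : IsDominated (fun X X' => absTaylor (σ 1) (patchKernel i X X')) g) :
    IsDominated (multiLayerKernel 1 n d σ) g := by
  -- The summands at the other patches are positive definite and can be dropped.
  refine hg.mono ?_
  convert! IsPosDefKernel.sum (Finset.univ.erase i) fun j _ =>
    isPosDefKernel_absTaylor_patchKernel (d := d) h1 j using 3 with X X'
  rw [sub_eq_iff_eq_add, Finset.sum_erase_add _ _ (Finset.mem_univ i)]
  rfl

theorem multiLayerKernel_succ_succ (k : ℕ) :
    multiLayerKernel (k + 2) n d σ = fun X X' : ImageSpace n d =>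
      absTaylor (σ (k + 2)) (multiLayerKernel (k + 1) n d σ X X') := rfl

theorem isPosDefKernel_multiLayerKernel (k : ℕ)
    (hσ : ∀ i ∈ Finset.Icc 1 (k + 1), HasTaylorOnReal (σ i)) :
    IsPosDefKernel (multiLayerKernel (k + 1) n d σ) := by
  induction k with
  | zero =>
    exact IsPosDefKernel.sum Finset.univ fun i _ =>
      isPosDefKernel_absTaylor_patchKernel (hσ 1 (by simp)) i
  | succ k ih =>
    exact (ih fun i hi => hσ i (by simp at hi ⊢; omega)).powerSeries (fun _ => abs_nonneg _)
      (hσ (k + 2) (by simp)).hasSum_abs_coeff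

theorem continuous_multiLayerKernel (k : ℕ)
    (hσ : ∀ i ∈ Finset.Icc 1 (k + 1), HasTaylorOnReal (σ i)) :
    Continuous fun z : ImageSpace n d × ImageSpace n d =>
      multiLayerKernel (k + 1) n d σ z.1 z.2 := by
  induction k with
  | zero =>
    have := (hσ 1 (by simp)).continuous_absTaylor
    simp only [multiLayerKernel, iterComp, id]
    fun_prop
  | succ k ih =>
    exact (hσ (k + 2) (by simp)).continuous_absTaylor.comp
      (ih fun i hi => hσ i (by simp at hi ⊢; omega))

theorem isDominated_representation {A : Architecture N n d} {p : ℕ → ℕ} (W : A.Weights p)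
    (hσ : ∀ i ∈ Finset.Icc 1 N, HasTaylorOnReal (σ i)) (k : ℕ) (hk : k + 1 ≤ N)
    (q : Fin (A.numPatches (k + 1))) (l : Fin (A.patchSize (k + 1))) (m : Fin (p (k + 1))) :
    IsDominated (multiLayerKernel (k + 1) n d σ)
      fun X => Architecture.representation W σ X (k + 1) hk q l m := by
  have hPD := isPosDefKernel_multiLayerKernel (n := n) (d := d) k
    fun i hi => hσ i (by simp at hi ⊢; omega)
  have hk1 := hσ (k + 1) (by simp; omega)
  simp only [Architecture.representation, Architecture.extractPatch, Architecture.convPool]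
  -- Pooling is linear, so the induction concerns a single activation output.
  refine .sum hPD _ fun r _ => .const_mul _ ?_
  induction k with
  | zero =>
    -- All input channels carry the same pixel, so summing the filter over them gives one vector,
    -- whatever `p 0` is.
    let w : EuclideanSpace ℝ (Fin d) := WithLp.toLp 2 fun l =>
      ∑ c, W.filter 0 m (Fin.cast A.patchSize_zero.symm l) c
    refine .multiLayerKernel_one hk1 (Fin.cast A.numPatches_zero r) ?_
    convert! (isDominated_patchKernel (Fin.cast A.numPatches_zero r) w).powerSeries
      (isPosDefKernel_patchKernel _) hk1 hk1.hasSum_abs_coeff using 3 with X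
    simp only [Architecture.representation, ← Finset.mul_sum, PiLp.inner_apply, w]
    exact Fintype.sum_equiv (finCongr A.patchSize_zero) _ _ fun l => by simp [mul_comm]
  | succ k ih =>
    have hσ' := fun i (hi : i ∈ Finset.Icc 1 (k + 1)) => hσ i (by simp at hi ⊢; omega)
    have hPD' := isPosDefKernel_multiLayerKernel (n := n) (d := d) k hσ'
    have hk' := hσ' (k + 1) (by simp)
    rw [multiLayerKernel_succ_succ]
    refine IsDominated.powerSeries hPD' hk1 hk1.hasSum_abs_coeff ?_
    refine .sum hPD' _ fun l _ => .sum hPD' _ fun c _ => ?_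
    simp only [mul_comm _ (W.filter _ _ _ _)]
    refine .const_mul _ ?_
    simp only [Architecture.representation, Architecture.extractPatch, Architecture.convPool]
    refine .sum hPD' _ fun r' _ => .const_mul _ ?_
    exact ih (by omega) r l _ hPD' hk' _ (Finset.mem_univ _)

theorem isDominated_networkFunction {k : ℕ} {A : Architecture (k + 1) n d} {p : ℕ → ℕ}
    (W : A.Weights p) (hσ : ∀ i ∈ Finset.Icc 1 (k + 1), HasTaylorOnReal (σ i)) :
    IsDominated (multiLayerKernel (k + 1) n d σ) (Architecture.networkFunction W σ) := by
  have hPD := isPosDefKernel_multiLayerKernel (n := n) (d := d) k hσ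
  refine .sum hPD _ fun l _ => .sum hPD _ fun c _ => ?_
  simp only [mul_comm _ (W.prediction _ _)]
  exact .const_mul _ (isDominated_representation W hσ k le_rfl _ _ _)

/-! ### Universality through polynomials in the coordinates. -/

/-- The `j`-th coordinate of the `i`-th patch. -/
noncomputable def patchCoordinate (i : Fin n) (j : Fin d) : C(ImageSpace n d, ℝ) where
  toFun X := (X i).1 j
  continuous_toFun := by fun_prop

theorem separatesPoints_adjoin_patchCoordinate :
    (Algebra.adjoin ℝ
      (Set.range fun ij : Fin n × Fin d => patchCoordinate ij.1 ij.2)).SeparatesPoints := by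
  intro X Y hXY
  contrapose! hXY
  funext i
  ext j
  exact hXY _ ⟨_, Algebra.subset_adjoin ⟨(i, j), rfl⟩, rfl⟩

/-- Only the second layer has to produce all degrees; the first and the later ones contribute their
linear term (`t := 1`). -/
theorem isDominated_of_mem_adjoin_patchCoordinate (k : ℕ)
    (hσ : ∀ i ∈ Finset.Icc 1 (k + 2), HasTaylorOnReal (σ i))
    (hne : ∀ i ∈ Finset.Icc 1 (k + 2), ∀ t : ℕ, iteratedDeriv t (σ i) 0 ≠ 0)
    {g : C(ImageSpace n d, ℝ)}
    (hg : g ∈ Algebra.adjoin ℝ (Set.range fun ij : Fin n × Fin d => patchCoordinate ij.1 ij.2)) :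
    IsDominated (multiLayerKernel (k + 2) n d σ) g := by
  have hpos (i) (hi : i ∈ Finset.Icc 1 (k + 2)) (t : ℕ) :
      0 < |iteratedDeriv t (σ i) 0 / (t.factorial : ℝ)| :=
    abs_pos.2 (div_ne_zero (hne i hi t) (Nat.cast_ne_zero.2 t.factorial_ne_zero))
  have hPD := isPosDefKernel_multiLayerKernel (n := n) (d := d) k
    fun i hi => hσ i (by simp at hi ⊢; omega)
  induction k with
  | zero =>
    have h1 := hσ 1 (by simp)
    refine IsDominated.mem_of_mem_adjoin hPD (hpos 2 (by simp))
      (hσ 2 (by simp)).hasSum_abs_coeff ?_ hg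
    rintro _ ⟨⟨i, j⟩, rfl⟩
    refine .multiLayerKernel_one h1 i ?_
    refine .of_pow (isPosDefKernel_patchKernel i) (fun _ => abs_nonneg _) h1.hasSum_abs_coeff
      (t := 1) (hpos 1 (by simp) 1) ?_
    simpa [patchCoordinate, EuclideanSpace.inner_single_left] using
      isDominated_patchKernel i (EuclideanSpace.single j 1)
  | succ k ih =>
    rw [multiLayerKernel_succ_succ]
    refine .of_pow hPD (fun _ => abs_nonneg _) (hσ (k + 3) (by simp)).hasSum_abs_coeff
      (t := 1) (hpos (k + 3) (by simp) 1) ?_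
    simp only [pow_one]
    exact ih (fun i hi => hσ i (by simp at hi ⊢; omega))
      (fun i hi => hne i (by simp at hi ⊢; omega))
      (fun i hi => hpos i (by simp at hi ⊢; omega))
      (isPosDefKernel_multiLayerKernel k fun i hi => hσ i (by simp at hi ⊢; omega))

end Layers

end ConvKernel

theorem mainTheorem2 (N n d : ℕ) (hN : 2 ≤ N) (hn : 1 ≤ n) (hd : 2 ≤ d) (σ : ℕ → ℝ → ℝ)
    (hσ : ∀ i ∈ Finset.Icc 1 N, ConvKernel.HasTaylorOnReal (σ i)) :
    (∃ hK : ConvKernel.IsPosDefKernel (ConvKernel.multiLayerKernel N n d σ),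
      ∀ A : ConvKernel.Architecture N n d,
        A.networkFunctions σ ⊆
          ConvKernel.rkhsFunctions (ConvKernel.multiLayerKernel N n d σ) hK) ∧
    ((∀ i ∈ Finset.Icc 1 N, ∀ t : ℕ, iteratedDeriv t (σ i) 0 ≠ 0) →
      ConvKernel.IsCUniversal (ConvKernel.multiLayerKernel N n d σ)) := by
  obtain ⟨k, rfl⟩ : ∃ k, N = k + 2 := ⟨N - 2, by omega⟩
  have hK := ConvKernel.isPosDefKernel_multiLayerKernel (n := n) (d := d) (k + 1) hσ
  refine ⟨⟨hK, fun A f hf => ?_⟩, fun hne => ⟨ConvKernel.continuous_multiLayerKernel (k + 1) hσ,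
    hK, ?_⟩⟩
  · simp only [ConvKernel.Architecture.networkFunctions, Set.mem_iUnion, Set.mem_ofPred_eq] at hf
    obtain ⟨p, _, W, rfl⟩ := hf
    exact (ConvKernel.isDominated_networkFunction W hσ).mem_rkhsFunctions hK
  · have h := ContinuousMap.subalgebra_topologicalClosure_eq_top_of_separatesPoints _
      (ConvKernel.separatesPoints_adjoin_patchCoordinate (n := n) (d := d))
    have hdense : Dense (Algebra.adjoin ℝ (Set.range fun ij : Fin n × Fin d =>
        ConvKernel.patchCoordinate ij.1 ij.2) : Set C(ConvKernel.ImageSpace n d, ℝ)) := by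
      rw [dense_iff_closure_eq, ← Subalgebra.topologicalClosure_coe, h, Algebra.coe_top]
    exact hdense.mono fun g hg =>
      (ConvKernel.isDominated_of_mem_adjoin_patchCoordinate k hσ hne hg).mem_rkhsFunctions hK
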